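/- \textbf{Setting.} In the Uniform Price Auction with uniform bidding, $k\ge 1$ identical units are sold to bidders $1,\dots,n$. Bidder $i$ has a non-negative, non-decreasing valuation $v_i:\{0,1,\dots,k\}\to\mathbb{R}$ with $v_i(0)=0$ that is submodular: $v_i(x)-v_i(x-1)\ge v_i(y)-v_i(y-1)$ for $1\le x<y\le k$. Bidder $i$ submits a price $\bar b_i\ge 0$ and a quantity $q_i\in\{0,\dots,k\}$; this is the vector of marginal bids with $b_i(j)=\bar b_i$ for $1\le j\le q_i$ and $b_i(j)=0$ for $q_i<j\le k$. Each of the $k$ highest marginal bids wins one unit, ties being broken by a fixed deterministic rule (whether or not bids equal to $0$ can win units is immaterial). If $x_i(b)$ is the number of units won by $i$ and $p(b)$ is the highest losing marginal bid ($0$ if there is none), the utility of $i$ is $v_i(x_i(b))-x_i(b)\,p(b)$, and the social welfare is $SW(b)=\sum_i v_i(x_i(b))$. Bidders never overbid: bidder $i$ may only use bids with $\sum_{j=1}^{s} b_i(j)\le v_i(s)$ for all $1\le s\le k$. A pure Nash equilibrium is a profile of such bids in which no bidder can increase his utility by switching to another such bid. The pure Price of Anarchy for $k$ units is $$\mathrm{PoA}_k=\sup\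 \frac{\max\{\sum_i v_i(y_i)\,:\,y_i\in\mathbb{Z}_{\ge0},\ \sum_i y_i\le k\}}{SW(b)},$$ the supremum being over all $n$, all profiles of submodular valuations of $n$ bidders, and all pure Nash equilibria $b$ (with $0/0$ read as $0$, and $a/0$ as $\infty$ for $a>0$). \textbf{Corollary.} For every choice of tie-breaking rules (one for each $n$), $$\mathrm{PoA}_k\ \ge\ \Bigl(1-\frac1e+\frac2k\Bigr)^{-1}\quad\text{for all } k\ge 9,\qquad\text{and}\qquad \mathrm{PoA}_k\ \le\ 3.1462\quad\text{for all } k\ge1 .$$ -/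

import Mathlib

open scoped ENNReal

namespace UniformPriceAuction

/-- A valuation over quantities `0, 1, …, k` of units: normalized, non-negative, non-decreasing and
submodular (decreasing marginal values). Only the values of `v` on `{0, …, k}` matter. -/
structure IsSubmodularValuation (k : ℕ) (v : ℕ → ℝ) : Prop where
  zero : v 0 = 0
  nonneg : ∀ x, x ≤ k → 0 ≤ v x
  mono : ∀ x y, x ≤ y → y ≤ k → v x ≤ v y
  submodular : ∀ x y, 1 ≤ x → x < y → y ≤ k → v y - v (y - 1) ≤ v x - v (x - 1)

/-- A bid in the uniform bidding interface: the bidder is willing to pay at most `price` per unit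
for up to `quantity ≤ k` units. -/
structure UniformBid (k : ℕ) where
  price : ℝ
  price_nonneg : 0 ≤ price
  quantity : ℕ
  quantity_le : quantity ≤ k

/-- The `j`-th marginal bid (`1 ≤ j ≤ k`) of a uniform bid: the vector
`(price, …, price, 0, …, 0)` with `quantity` leading entries equal to `price`. -/
noncomputable def UniformBid.marginal {k : ℕ} (b : UniformBid k) (j : ℕ) : ℝ :=
  if j ≤ b.quantity then b.price else 0

/-- The quantities `x i` arise by granting a unit to each of the `k` highest marginal bids of the
profile `b`. The winning bids of `i` are those with index `1, …, x i`, the losing ones those with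
index `x i + 1, …, k`. Ties are broken arbitrarily. Units may stay unsold only if all losing bids
are `0`; hence both the convention that bids of `0` can win units and the convention that they
cannot are covered. -/
structure IsAllocation {n k : ℕ} (b : Fin n → UniformBid k) (x : Fin n → ℕ) : Prop where
  sum_le : ∑ i, x i ≤ k
  losing_le_winning : ∀ i j i' j', 1 ≤ j → j ≤ x i → x i' < j' → j' ≤ k →
    (b i').marginal j' ≤ (b i).marginal j
  losing_eq_zero : ∑ i, x i < k → ∀ i j, x i < j → j ≤ k → (b i).marginal j = 0

/-- An allocation rule for `n` bidders and `k` units: the standard multi-unit allocation together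
with a deterministic rule to break ties. -/
structure AllocationRule (n k : ℕ) where
  alloc : (Fin n → UniformBid k) → Fin n → ℕ
  isAllocation : ∀ b, IsAllocation b (alloc b)

/-- The uniform price: the highest losing marginal bid (and `sSup ∅ = 0` if no bid loses). -/
noncomputable def uniformPrice {n k : ℕ} (R : AllocationRule n k) (b : Fin n → UniformBid k) : ℝ :=
  sSup {β : ℝ | ∃ (i : Fin n) (j : ℕ), R.alloc b i < j ∧ j ≤ k ∧ β = (b i).marginal j}

/-- The utility of bidder `i` under the uniform pricing rule. -/
noncomputable def utility {n k : ℕ} (R : AllocationRule n k) (v : Fin n → ℕ → ℝ)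
    (b : Fin n → UniformBid k) (i : Fin n) : ℝ :=
  v i (R.alloc b i) - (R.alloc b i : ℝ) * uniformPrice R b

/-- No-overbidding: for every number `s` of units, the first `s` marginal bids sum to at most the
value of `s` units. -/
def NoOverbidding {k : ℕ} (v : ℕ → ℝ) (b : UniformBid k) : Prop :=
  ∀ s, 1 ≤ s → s ≤ k → ∑ j ∈ Finset.Icc 1 s, b.marginal j ≤ v s

/-- A pure Nash equilibrium of the Uniform Price Auction under uniform bidding, where bidders never
overbid. -/
def IsPureNash {n k : ℕ} (R : AllocationRule n k) (v : Fin n → ℕ → ℝ)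
    (b : Fin n → UniformBid k) : Prop :=
  (∀ i, NoOverbidding (v i) (b i)) ∧
    ∀ (i : Fin n) (b' : UniformBid k), NoOverbidding (v i) b' →
      utility R v (Function.update b i b') i ≤ utility R v b i

/-- The social welfare of a bidding profile. -/
noncomputable def socialWelfare {n k : ℕ} (R : AllocationRule n k) (v : Fin n → ℕ → ℝ)
    (b : Fin n → UniformBid k) : ℝ :=
  ∑ i, v i (R.alloc b i)

/-- The optimal social welfare over all distributions of at most `k` units (a maximum over a
finite non-empty set). -/
noncomputable def optimalWelfare {n : ℕ} (k : ℕ) (v : Fin n → ℕ → ℝ) : ℝ :=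
  sSup {w : ℝ | ∃ y : Fin n → ℕ, ∑ i, y i ≤ k ∧ w = ∑ i, v i (y i)}

/-- The pure Price of Anarchy for `k` units, submodular bidders and uniform bidding, given an
allocation rule for each number `n` of bidders: the supremum of the ratio of the optimal social
welfare to that of a pure Nash equilibrium, over all `n`, all profiles of submodular valuations and
all equilibria. In `ℝ≥0∞`, a ratio `a / 0` with `0 < a` is `∞`, and `0 / 0 = 0`. -/
noncomputable def pureNashPoA {k : ℕ} (R : (n : ℕ) → AllocationRule n k) : ℝ≥0∞ :=
  ⨆ (n : ℕ) (v : Fin n → ℕ → ℝ) (_ : ∀ i, IsSubmodularValuation k (v i))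
    (b : Fin n → UniformBid k) (_ : IsPureNash (R n) v b),
    ENNReal.ofReal (optimalWelfare k v) / ENNReal.ofReal (socialWelfare (R n) v b)

end UniformPriceAuction

/-! Upper bound: the constant 3 suffices. Fix an equilibrium allocation `x` and a distribution `y`.
Let `U` be the bidders with `x i < y i`, `B` the equilibrium welfare of the others, and `M` the
number of units not held by `U`. For `i ∈ U` let `d` be the average value of the `m = y i - x i`
missing units. If `m ≤ x i`, concavity gives `m * d ≤ v i (x i)`. Otherwise a deviation to `2 * x i
+ 1` units at price `d / 2` would be profitable if it won them all, so bidders outside `U` win at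
least `M - x i` units with bids of at least `d / 2`. No-overbidding turns this into `(M - x i) * d /
2 ≤ B`. Scaling by `m / M` charges `i` only a share of `B`; since the missing units total at most
`M`, the shares sum to at most `B`, and the total is at most three times the equilibrium welfare.

Lower bound: an additive bidder facing a unit-demand bidder who blocks all `k` units gives ratio `2
- 1 / k`, which dominates the required expression. -/

namespace UniformPriceAuction

open Finset

variable {n k : ℕ}

/-! ### Discrete concavity of submodular valuations. -/

namespace IsSubmodularValuation

variable {v : ℕ → ℝ}

/-- Increments of a submodular valuation over a block of units are at most the block length times
any earlier marginal value. -/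
theorem sub_le_mul_marginal (h : IsSubmodularValuation k v) {a : ℕ} (ha : 1 ≤ a) (t : ℕ)
    (hk : a + t ≤ k) : v (a + t) - v a ≤ t * (v a - v (a - 1)) := by
  induction t with
  | zero => simp
  | succ t ih =>
    have h1 := ih (by omega)
    have h2 := h.submodular a (a + (t + 1)) ha (by omega) hk
    have h3 : a + (t + 1) - 1 = a + t := by omega
    rw [h3] at h2
    push_cast
    linarith

/-- Increments of a submodular valuation over a block of units are at least the block length times
the last marginal value. -/
theorem mul_marginal_le_sub (h : IsSubmodularValuation k v) (a t : ℕ) (hk : a + t + 1 ≤ k) :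
    t * (v (a + t + 1) - v (a + t)) ≤ v (a + t) - v a := by
  induction t with
  | zero => simp
  | succ t ih =>
    have h1 := ih (by omega)
    have h2 := h.submodular (a + t + 1) (a + (t + 1) + 1) (by omega) (by omega) hk
    have e1 : a + (t + 1) = a + t + 1 := by omega
    simp only [e1, Nat.add_sub_cancel] at h2 ⊢
    have h3 : (t : ℝ) * (v (a + t + 1 + 1) - v (a + t + 1)) ≤
        t * (v (a + t + 1) - v (a + t)) := mul_le_mul_of_nonneg_left h2 (by positivity)
    push_cast
    linarith

/-- Discrete concavity: slopes over consecutive blocks are decreasing. -/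
theorem slope_anti (h : IsSubmodularValuation k v) (a s t : ℕ) (hk : a + s + t ≤ k) :
    s * (v (a + s + t) - v (a + s)) ≤ t * (v (a + s) - v a) := by
  rcases Nat.eq_zero_or_pos t with rfl | ht
  · simp
  rcases Nat.eq_zero_or_pos s with rfl | hs
  · simp
  have h1 := h.sub_le_mul_marginal (a := a + s) (by omega) t hk
  have h2 := h.mul_marginal_le_sub a (s - 1) (by omega)
  have e1 : a + (s - 1) + 1 = a + s := by omega
  have e2 : a + (s - 1) = a + s - 1 := by omega
  rw [e1, e2, Nat.cast_sub hs] at h2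
  push_cast at h2
  have h3 : (s : ℝ) * (v (a + s) - v (a + s - 1)) ≤ v (a + s) - v a := by linarith
  calc (s : ℝ) * (v (a + s + t) - v (a + s)) ≤ s * (t * (v (a + s) - v (a + s - 1))) :=
        mul_le_mul_of_nonneg_left h1 (by positivity)
    _ = t * (s * (v (a + s) - v (a + s - 1))) := by ring
    _ ≤ _ := mul_le_mul_of_nonneg_left h3 (by positivity)

/-- If the last `m` of `x + m` units have average value `d`, then the units from `x` to `x + t`
have at least this average value, for `t ≤ m`. -/
theorem mul_le_sub_of_eq (h : IsSubmodularValuation k v) {x m t : ℕ} {d : ℝ} (ht : t ≤ m)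
    (hm : x + m ≤ k) (hd : m * d = v (x + m) - v x) : t * d ≤ v (x + t) - v x := by
  obtain ⟨r, rfl⟩ := Nat.exists_eq_add_of_le ht
  have h1 := h.slope_anti x t r (by omega)
  rw [← add_assoc] at hd
  push_cast at hd
  rcases Nat.eq_zero_or_pos (t + r) with h0 | h0
  · have : t = 0 := by omega
    simp [this]
  have hp : (0 : ℝ) < t + r := by exact_mod_cast h0
  nlinarith

/-- If the last `m ≥ 1` of `x + m` units have average value `d`, then the first `s ≤ x + m` units
have at least this average value. -/
theorem mul_le_of_eq (h : IsSubmodularValuation k v) {x m s : ℕ} {d : ℝ} (hm1 : 1 ≤ m)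
    (hs : s ≤ x + m) (hm : x + m ≤ k) (hd : m * d = v (x + m) - v x) : s * d ≤ v s := by
  have hmp : (0 : ℝ) < m := by exact_mod_cast hm1
  rcases le_total s x with hsx | hsx
  · obtain ⟨r, rfl⟩ := Nat.exists_eq_add_of_le hsx
    -- The units from `s` to `x` average at least `d`, hence so do those from `s` to `x + m`, and
    -- the first `s` units average no less than these.
    have h1 := h.slope_anti 0 s (r + m) (by omega)
    have h2 := h.slope_anti s r m (by omega)
    simp only [zero_add, h.zero, ← add_assoc] at h1
    push_cast at h1
    rw [← hd] at h2
    have h4 : (r : ℝ) * d ≤ v (s + r) - v s := by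
      refine le_of_mul_le_mul_left ?_ hmp
      linarith
    have h5 : ((r : ℝ) + m) * (s * d) ≤ (r + m) * v s := by
      have : (s : ℝ) * ((r + m) * d) ≤ s * (v (s + r + m) - v s) :=
        mul_le_mul_of_nonneg_left (by linarith) (by positivity)
      linarith
    exact le_of_mul_le_mul_left h5 (by positivity)
  · obtain ⟨t, rfl⟩ := Nat.exists_eq_add_of_le hsx
    have h1 := h.mul_le_sub_of_eq (t := t) (by omega) hm hd
    have h2 := h.slope_anti 0 x m (by omega)
    simp only [zero_add, h.zero, sub_zero] at h2
    rw [← hd] at h2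
    have h3 : (x : ℝ) * d ≤ v x := le_of_mul_le_mul_left (by linarith) hmp
    push_cast
    linarith

end IsSubmodularValuation

/-! ### Marginal bids, the uniform price and counts of high bids. -/

theorem UniformBid.marginal_nonneg (b : UniformBid k) (j : ℕ) : 0 ≤ b.marginal j := by
  unfold UniformBid.marginal
  split_ifs
  exacts [b.price_nonneg, le_rfl]

theorem UniformBid.marginal_anti (b : UniformBid k) : Antitone b.marginal := by
  intro i j hij
  unfold UniformBid.marginal
  split_ifs <;> first | omega | exact le_rfl | exact b.price_nonneg

theorem IsAllocation.le {b : Fin n → UniformBid k} {x : Fin n → ℕ} (h : IsAllocation b x)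
    (i : Fin n) : x i ≤ k :=
  (single_le_sum (fun _ _ => Nat.zero_le _) (mem_univ i)).trans h.sum_le

theorem uniformPrice_nonneg (R : AllocationRule n k) (b : Fin n → UniformBid k) :
    0 ≤ uniformPrice R b := by
  apply Real.sSup_nonneg
  rintro β ⟨i, j, -, -, rfl⟩
  exact (b i).marginal_nonneg j

theorem uniformPrice_le {R : AllocationRule n k} {b : Fin n → UniformBid k} {c : ℝ} (hc : 0 ≤ c)
    (h : ∀ i j, R.alloc b i < j → j ≤ k → (b i).marginal j ≤ c) : uniformPrice R b ≤ c := by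
  apply Real.sSup_le _ hc
  rintro β ⟨i, j, h1, h2, rfl⟩
  exact h i j h1 h2

theorem marginal_le_uniformPrice {R : AllocationRule n k} {b : Fin n → UniformBid k} {i : Fin n}
    {j : ℕ} (h1 : R.alloc b i < j) (h2 : j ≤ k) : (b i).marginal j ≤ uniformPrice R b := by
  -- Index `0` is not a real bid, but the formula gives it the full price, so it bounds all marginal
  -- bids.
  refine le_csSup ⟨∑ i, (b i).marginal 0, ?_⟩ ⟨i, j, h1, h2, rfl⟩
  rintro β ⟨i, j, -, -, rfl⟩
  exact ((b i).marginal_anti (Nat.zero_le j)).trans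
    (single_le_sum (f := fun i => (b i).marginal 0)
      (fun i _ => (b i).marginal_nonneg 0) (mem_univ i))

theorem utility_le (R : AllocationRule n k) (v : Fin n → ℕ → ℝ) (b : Fin n → UniformBid k)
    (i : Fin n) : utility R v b i ≤ v i (R.alloc b i) :=
  sub_le_self _ (mul_nonneg (Nat.cast_nonneg _) (uniformPrice_nonneg R b))

/-- The number of units `1, …, x` for which the marginal bid is at least `θ`. -/
noncomputable def bidsAbove (b : UniformBid k) (x : ℕ) (θ : ℝ) : ℕ :=
  #{j ∈ Icc 1 x | θ ≤ b.marginal j}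

theorem bidsAbove_le (b : UniformBid k) (x : ℕ) (θ : ℝ) : bidsAbove b x θ ≤ x :=
  (card_filter_le _ _).trans (by simp)

theorem le_bidsAbove {b : UniformBid k} {x y : ℕ} {θ : ℝ} (hxy : y ≤ x)
    (h : 1 ≤ y → θ ≤ b.marginal y) : y ≤ bidsAbove b x θ := by
  have : Icc 1 y ⊆ {j ∈ Icc 1 x | θ ≤ b.marginal j} := by
    intro j hj
    rw [mem_Icc] at hj
    rw [mem_filter, mem_Icc]
    exact ⟨⟨hj.1, hj.2.trans hxy⟩, (h (by omega)).trans (b.marginal_anti hj.2)⟩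
  simpa [bidsAbove] using card_le_card this

/-- No-overbidding converts a count of high winning bids into welfare of their owner. -/
theorem bidsAbove_mul_le {v : ℕ → ℝ} (hv : IsSubmodularValuation k v) {b : UniformBid k}
    (hb : NoOverbidding v b) {x : ℕ} (hx : x ≤ k) (θ : ℝ) : bidsAbove b x θ * θ ≤ v x := by
  rcases Nat.eq_zero_or_pos x with rfl | hx0
  · simp [bidsAbove, hv.zero]
  · calc (bidsAbove b x θ : ℝ) * θ = ∑ j ∈ Icc 1 x with θ ≤ b.marginal j, θ := by
          simp [bidsAbove]
      _ ≤ ∑ j ∈ Icc 1 x with θ ≤ b.marginal j, b.marginal j :=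
          sum_le_sum fun j hj => (mem_filter.1 hj).2
      _ ≤ ∑ j ∈ Icc 1 x, b.marginal j :=
          sum_le_sum_of_subset_of_nonneg (filter_subset _ _) fun j _ _ => b.marginal_nonneg j
      _ ≤ v x := hb x hx0 hx

/-! ### Unilateral deviations. -/

/-- A bidder who wins at least the `s` units he positively bids for at price `θ` has utility at
least `v s - s * θ`. -/
theorem le_utility_of_le_alloc {R : AllocationRule n k} {v : Fin n → ℕ → ℝ}
    {b : Fin n → UniformBid k} {i : Fin n} (hv : IsSubmodularValuation k (v i))
    (hs : 1 ≤ (b i).quantity) (h : (b i).quantity ≤ R.alloc b i) :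
    v i (b i).quantity - (b i).quantity * (b i).price ≤ utility R v b i := by
  have hA := R.isAllocation b
  rcases h.eq_or_lt with h | h
  · have : uniformPrice R b ≤ (b i).price := by
      refine uniformPrice_le (b i).price_nonneg fun j l h1 h2 => ?_
      have := hA.losing_le_winning i (b i).quantity j l hs h.le h1 h2
      simpa [UniformBid.marginal] using this
    unfold utility
    rw [← h]
    have := mul_le_mul_of_nonneg_left this (Nat.cast_nonneg (α := ℝ) (b i).quantity)
    linarith
  -- A zero marginal bid wins here, so every losing bid is zero.
  · have : uniformPrice R b ≤ 0 := by
      refine uniformPrice_le le_rfl fun j l h1 h2 => ?_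
      have := hA.losing_le_winning i (R.alloc b i) j l (by omega) le_rfl h1 h2
      simpa [UniformBid.marginal, not_le.2 h] using this
    have h0 : uniformPrice R b = 0 := le_antisymm this (uniformPrice_nonneg R b)
    unfold utility
    rw [h0]
    have := hv.mono _ _ h.le (hA.le i)
    have := mul_nonneg (Nat.cast_nonneg (α := ℝ) (b i).quantity) (b i).price_nonneg
    linarith

/-- If a bidder fails to win all `s` units by a deviation to the price `θ > 0`, then the others win
more than `k - s` units by bids of at least `θ` in the original profile, or all their units. -/
theorem lt_or_le_of_alloc_update_lt (R : AllocationRule n k) (b : Fin n → UniformBid k) (i : Fin n)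
    (b' : UniformBid k) (hθ : 0 < b'.price)
    (h : R.alloc (Function.update b i b') i < b'.quantity) :
    k < b'.quantity + ∑ j ∈ univ.erase i, bidsAbove (b j) (R.alloc b j) b'.price ∨
      k ≤ R.alloc b i + ∑ j ∈ univ.erase i, bidsAbove (b j) (R.alloc b j) b'.price := by
  set c := Function.update b i b' with hc
  have hci : c i = b' := by simp [hc]
  have hcj : ∀ j, j ≠ i → c j = b j := fun j hj => by simp [hc, hj]
  have hA := R.isAllocation b
  have hA' := R.isAllocation c
  have hlose : (c i).marginal b'.quantity = b'.price := by simp [hci, UniformBid.marginal]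
  -- The deviator has a positive losing bid, so no unit stays unsold.
  have hsum : ∑ j, R.alloc c j = k := by
    by_contra hne
    have := hA'.losing_eq_zero (lt_of_le_of_ne hA'.sum_le hne) i _ h b'.quantity_le
    linarith
  have hwin : ∀ j, j ≠ i → 1 ≤ R.alloc c j → b'.price ≤ (b j).marginal (R.alloc c j) := by
    intro j hj h1
    have := hA'.losing_le_winning j _ i _ h1 le_rfl h b'.quantity_le
    rwa [hlose, hcj j hj] at this
  by_cases hcase : ∃ j, j ≠ i ∧ R.alloc b j < R.alloc c j
  · right
    -- The unit that `j` gains corresponds to a bid of at least `b'.price` that lost in `b`, so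
    -- every winning bid in `b` is at least that high.
    obtain ⟨j, hji, hj⟩ := hcase
    have hjb := hwin j hji (by omega)
    have hall : ∑ j, R.alloc b j = k := by
      by_contra hne
      have := hA.losing_eq_zero (lt_of_le_of_ne hA.sum_le hne) j _ hj (hA'.le j)
      linarith
    rw [← add_sum_erase _ _ (mem_univ i)] at hall
    refine hall.ge.trans (Nat.add_le_add_left (sum_le_sum fun l _ => ?_) _)
    exact le_bidsAbove le_rfl fun hl1 =>
      hjb.trans (hA.losing_le_winning l _ j _ hl1 le_rfl hj (hA'.le j))
  · left
    push Not at hcase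
    rw [← add_sum_erase _ _ (mem_univ i)] at hsum
    have : ∑ j ∈ univ.erase i, R.alloc c j ≤
        ∑ j ∈ univ.erase i, bidsAbove (b j) (R.alloc b j) b'.price :=
      sum_le_sum fun j hj => le_bidsAbove (hcase j (ne_of_mem_erase hj))
        (hwin j (ne_of_mem_erase hj))
    omega

/-- In an equilibrium, if a bidder with `x` units values further `m > x` units at `d > 0` each on
average, then all but `x` of the units not won by him are won by bids of at least `d / 2`. -/
theorem IsPureNash.le_add_sum_bidsAbove {R : AllocationRule n k} {v : Fin n → ℕ → ℝ}
    {b : Fin n → UniformBid k} (hb : IsPureNash R v b) (i : Fin n)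
    (hv : IsSubmodularValuation k (v i)) {m : ℕ} {d : ℝ} (hm : R.alloc b i < m)
    (hk : R.alloc b i + m ≤ k) (hd0 : 0 < d)
    (hd : m * d = v i (R.alloc b i + m) - v i (R.alloc b i)) :
    k ≤ 2 * R.alloc b i + ∑ j ∈ univ.erase i, bidsAbove (b j) (R.alloc b j) (d / 2) := by
  set x := R.alloc b i with hx
  -- At price `d / 2`, winning `s ≥ x` units gains at least `(s - x) * d - s * d / 2`, which is
  -- positive once `s > 2 * x`.
  let b' : UniformBid k := ⟨d / 2, by positivity, x + (x + 1), by omega⟩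
  have hno : NoOverbidding (v i) b' := by
    intro s hs1 hsk
    have key : ∀ t, t ≤ x + (x + 1) → (t : ℝ) * (d / 2) ≤ v i t := by
      intro t ht
      have h1 := hv.mul_le_of_eq (by omega) (s := t) (by omega) hk hd
      have : (0 : ℝ) ≤ t * d := by positivity
      linarith
    calc ∑ j ∈ Icc 1 s, b'.marginal j
        = ∑ j ∈ Icc 1 s with j ≤ x + (x + 1), d / 2 := by
          rw [sum_filter]; rfl
      _ ≤ ∑ j ∈ Icc 1 (min s (x + (x + 1))), d / 2 := by
          refine sum_le_sum_of_subset_of_nonneg ?_ fun _ _ _ => by positivity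
          intro j
          simp only [mem_filter, mem_Icc]
          omega
      _ = (min s (x + (x + 1)) : ℕ) * (d / 2) := by simp
      _ ≤ v i (min s (x + (x + 1))) := key _ (min_le_right _ _)
      _ ≤ v i s := hv.mono _ _ (min_le_left _ _) hsk
  have hnash := hb.2 i b' hno
  have hlt : R.alloc (Function.update b i b') i < b'.quantity := by
    by_contra hge
    have hci : Function.update b i b' i = b' := by simp
    have h1 := le_utility_of_le_alloc (R := R) (v := v) (b := Function.update b i b') (i := i) hv
      (by rw [hci]; change 1 ≤ x + (x + 1); omega) (by rw [hci]; omega)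
    rw [hci] at h1
    change v i (x + (x + 1)) - ((x + (x + 1) : ℕ) : ℝ) * (d / 2) ≤ _ at h1
    have h2 := utility_le R v b i
    have h3 := hv.mul_le_sub_of_eq (t := x + 1) (by omega) hk hd
    push_cast at h1 h3
    rw [← hx] at h2
    linarith
  have := lt_or_le_of_alloc_update_lt R b i b' (by change 0 < d / 2; positivity) hlt
  change k < x + (x + 1) + ∑ j ∈ univ.erase i, bidsAbove (b j) (R.alloc b j) (d / 2) ∨
    k ≤ x + ∑ j ∈ univ.erase i, bidsAbove (b j) (R.alloc b j) (d / 2) at this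
  omega

/-! ### The upper bound. -/

/-- The welfare of an equilibrium is at least a third of the welfare of any other distribution. -/
theorem IsPureNash.sum_le_three_mul {R : AllocationRule n k} {v : Fin n → ℕ → ℝ}
    {b : Fin n → UniformBid k} (hb : IsPureNash R v b)
    (hv : ∀ i, IsSubmodularValuation k (v i)) {y : Fin n → ℕ} (hy : ∑ i, y i ≤ k) :
    ∑ i, v i (y i) ≤ 3 * socialWelfare R v b := by
  set x := R.alloc b with hx
  have hA : IsAllocation b x := R.isAllocation b
  have hyk : ∀ i, y i ≤ k := fun i =>
    (single_le_sum (fun _ _ => Nat.zero_le _) (mem_univ i)).trans hy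
  have hvx : ∀ i, 0 ≤ v i (x i) := fun i => (hv i).nonneg _ (hA.le i)
  let U : Finset (Fin n) := {i | x i < y i}
  let O : Finset (Fin n) := {i | ¬ x i < y i}
  set B : ℝ := ∑ j ∈ O, v j (x j) with hB
  have hB0 : 0 ≤ B := sum_nonneg fun j _ => hvx j
  have split : ∀ f : Fin n → ℝ, ∑ i, f i = ∑ i ∈ U, f i + ∑ i ∈ O, f i := fun f =>
    (sum_filter_add_sum_filter_not _ _ _).symm
  have hUx : ∑ i ∈ U, y i ≤ k :=
    (sum_le_sum_of_subset (subset_univ U)).trans hy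
  set M : ℝ := k - ∑ i ∈ U, (x i : ℝ) with hM
  have hmM : ∑ i ∈ U, ((y i : ℝ) - x i) ≤ M := by
    rw [sum_sub_distrib]
    have : ∑ i ∈ U, (y i : ℝ) ≤ k := by exact_mod_cast hUx
    linarith
  have hpos : ∀ i ∈ U, (1 : ℝ) ≤ (y i : ℝ) - x i := by
    intro i hi
    have : x i + 1 ≤ y i := (mem_filter.1 hi).2
    have : (x i : ℝ) + 1 ≤ y i := by exact_mod_cast this
    linarith
  have main : ∀ i ∈ U, v i (y i) ≤ 2 * (((y i : ℝ) - x i) / M * B) + 2 * v i (x i) := by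
    intro i hi
    have hlt : x i < y i := (mem_filter.1 hi).2
    obtain ⟨m, hm⟩ := Nat.exists_eq_add_of_le hlt.le
    have hm1 : 1 ≤ m := by omega
    have hmr : (y i : ℝ) - x i = m := by rw [hm]; push_cast; ring
    have hmp : (0 : ℝ) < m := by exact_mod_cast hm1
    have hmle : (m : ℝ) ≤ M := by
      rw [← hmr]
      exact (single_le_sum (f := fun i => (y i : ℝ) - x i)
        (fun i hi => by linarith [hpos i hi]) hi).trans hmM
    have hMp : 0 < M := hmp.trans_le hmle
    have hxk : x i + m ≤ k := by rw [← hm]; exact hyk i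
    rw [hmr, hm]
    set d : ℝ := (v i (x i + m) - v i (x i)) / m with hd'
    have hd : m * d = v i (x i + m) - v i (x i) := by rw [hd']; field_simp
    have hd0 : 0 ≤ d :=
      div_nonneg (sub_nonneg.2 ((hv i).mono _ _ (by omega) hxk)) hmp.le
    have hxd : (x i : ℝ) * d ≤ v i (x i) := (hv i).mul_le_of_eq hm1 (by omega) hxk hd
    have hq : 0 ≤ (m : ℝ) / M * B := by positivity
    suffices h : m * d ≤ 2 * (m / M * B) + x i * d by linarith
    rcases le_or_gt m (x i) with hmx | hmx
    · have : (m : ℝ) * d ≤ x i * d := mul_le_mul_of_nonneg_right (by exact_mod_cast hmx) hd0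
      linarith
    rcases hd0.eq_or_lt with h0 | h0
    · rw [← h0]; linarith
    have hkey := hb.le_add_sum_bidsAbove i (hv i) hmx hxk h0 hd
    rw [← hx] at hkey
    have hkey' : (k : ℝ) ≤ 2 * x i +
        ∑ j ∈ univ.erase i, (bidsAbove (b j) (x j) (d / 2) : ℝ) := by exact_mod_cast hkey
    -- Bidders of `U` are credited with all their units, so only bids from `O` remain to be charged.
    have hsplit : ∑ j ∈ univ.erase i, (bidsAbove (b j) (x j) (d / 2) : ℝ) ≤
        ∑ j ∈ U, (x j : ℝ) - x i + ∑ j ∈ O, (bidsAbove (b j) (x j) (d / 2) : ℝ) := by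
      have h1 := split fun j => (bidsAbove (b j) (x j) (d / 2) : ℝ)
      rw [← add_sum_erase _ _ (mem_univ i), ← add_sum_erase _ _ hi] at h1
      rw [← add_sum_erase _ _ hi]
      have h2 : ∑ j ∈ U.erase i, (bidsAbove (b j) (x j) (d / 2) : ℝ) ≤
          ∑ j ∈ U.erase i, (x j : ℝ) :=
        sum_le_sum fun j _ => by exact_mod_cast bidsAbove_le (b j) (x j) (d / 2)
      linarith
    have hOB : (∑ j ∈ O, (bidsAbove (b j) (x j) (d / 2) : ℝ)) * (d / 2) ≤ B := by
      rw [sum_mul]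
      exact sum_le_sum fun j _ => bidsAbove_mul_le (hv j) (hb.1 j) (hA.le j) _
    have h1 : (M - x i) * (d / 2) ≤ B :=
      (mul_le_mul_of_nonneg_right (by linarith) (by positivity)).trans hOB
    -- The weight `m / M` makes the charges to `B` summable over `U`; the loss `m / M * (x i * d)`
    -- is absorbed by `v i (x i)`.
    have h2 : (m : ℝ) / M * ((M - x i) * (d / 2)) ≤ m / M * B :=
      mul_le_mul_of_nonneg_left h1 (by positivity)
    have h3 : (m : ℝ) / M * ((M - x i) * (d / 2)) = m * d / 2 - m / M * (x i * d) / 2 := by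
      field_simp
    have h4 : (m : ℝ) / M * (x i * d) ≤ 1 * (x i * d) :=
      mul_le_mul_of_nonneg_right ((div_le_one hMp).2 hmle) (by positivity)
    linarith
  have hUsum : ∑ i ∈ U, v i (y i) ≤ 2 * B + 2 * ∑ i ∈ U, v i (x i) := by
    have h1 := sum_le_sum main
    rw [sum_add_distrib, ← mul_sum, ← mul_sum, ← sum_mul, ← sum_div] at h1
    have h2 : (∑ i ∈ U, ((y i : ℝ) - x i)) / M * B ≤ 1 * B := by
      refine mul_le_mul_of_nonneg_right (div_le_one_of_le₀ hmM ?_) hB0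
      exact (sum_nonneg fun i hi => by linarith [hpos i hi]).trans hmM
    linarith
  have hOsum : ∑ i ∈ O, v i (y i) ≤ B :=
    sum_le_sum fun i hi => (hv i).mono _ _ (not_lt.1 (mem_filter.1 hi).2) (hA.le i)
  have hSW : socialWelfare R v b = ∑ i ∈ U, v i (x i) + B := split fun i => v i (x i)
  have hU0 : 0 ≤ ∑ i ∈ U, v i (x i) := sum_nonneg fun i _ => hvx i
  rw [split, hSW]
  linarith

theorem pureNashPoA_le_three (R : (n : ℕ) → AllocationRule n k) : pureNashPoA R ≤ 3 := by
  refine iSup_le fun n => iSup_le fun v => iSup_le fun hv => iSup_le fun b => iSup_le fun hb => ?_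
  refine ENNReal.div_le_of_le_mul ?_
  rw [← ENNReal.ofReal_ofNat 3, ← ENNReal.ofReal_mul (by norm_num)]
  refine ENNReal.ofReal_le_ofReal (csSup_le ⟨_, 0, by simp, rfl⟩ ?_)
  rintro w ⟨y, hy, rfl⟩
  exact hb.sum_le_three_mul hv hy

/-! ### The lower bound instance. -/

theorem sum_le_optimalWelfare {v : Fin n → ℕ → ℝ} (hv : ∀ i, IsSubmodularValuation k (v i))
    {y : Fin n → ℕ} (hy : ∑ i, y i ≤ k) : ∑ i, v i (y i) ≤ optimalWelfare k v := by
  refine le_csSup ⟨∑ i, v i k, ?_⟩ ⟨y, hy, rfl⟩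
  rintro w ⟨z, hz, rfl⟩
  exact sum_le_sum fun i _ => (hv i).mono _ _
    ((single_le_sum (fun _ _ => Nat.zero_le _) (mem_univ i)).trans hz) le_rfl

theorem isSubmodularValuation_natCast (k : ℕ) : IsSubmodularValuation k (fun s => (s : ℝ)) where
  zero := by simp
  nonneg _ _ := Nat.cast_nonneg _
  mono _ _ h _ := Nat.cast_le.2 h
  submodular x y hx hxy _ := by
    simp [Nat.cast_sub hx, Nat.cast_sub (hx.trans hxy.le)]

theorem isSubmodularValuation_unitDemand (k : ℕ) {c : ℝ} (hc : 0 ≤ c) :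
    IsSubmodularValuation k (fun s => if s = 0 then 0 else c) where
  zero := by simp
  nonneg _ _ := by split_ifs <;> simp [hc]
  mono x y h _ := by
    split_ifs <;> first | omega | simp
  submodular x y hx hxy _ := by
    split_ifs <;> first | omega | simp [hc]

/-- An additive bidder who abstains and a bidder interested in a single unit who bids for all of
them form an equilibrium with about half of the optimal welfare. -/
theorem ofReal_two_sub_inv_le_pureNashPoA (hk : 1 ≤ k) (R : (n : ℕ) → AllocationRule n k) :
    ENNReal.ofReal (2 - 1 / (k : ℝ)) ≤ pureNashPoA R := by
  have hkp : (0 : ℝ) < k := by exact_mod_cast hk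
  let v : Fin 2 → ℕ → ℝ := ![fun s => (s : ℝ), fun s => if s = 0 then 0 else (k : ℝ)]
  let b : Fin 2 → UniformBid k :=
    ![⟨0, le_rfl, 0, Nat.zero_le k⟩, ⟨1, zero_le_one, k, le_rfl⟩]
  have hv : ∀ i, IsSubmodularValuation k (v i) := by
    intro i
    fin_cases i
    exacts [isSubmodularValuation_natCast k, isSubmodularValuation_unitDemand k hkp.le]
  have hb0 : ∀ j, (b 0).marginal j = 0 := fun j => by simp [b, UniformBid.marginal]
  have hb1 : ∀ j, j ≤ k → (b 1).marginal j = 1 := fun j hj => by simp [b, UniformBid.marginal, hj]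
  have hA := (R 2).isAllocation b
  -- Tie-breaking plays no role: a bid of `1` can lose neither to a zero bid nor to an unsold unit.
  have hx1 : (R 2).alloc b 1 = k := by
    by_contra hne
    have hlt : (R 2).alloc b 1 < k := lt_of_le_of_ne (hA.le 1) hne
    have hlose := hb1 k le_rfl
    rcases Nat.eq_zero_or_pos ((R 2).alloc b 0) with h0 | h0
    · have := hA.losing_eq_zero (by rw [Fin.sum_univ_two]; omega) 1 k hlt le_rfl
      linarith
    · have := hA.losing_le_winning 0 _ 1 k h0 le_rfl hlt le_rfl
      rw [hb0] at this
      linarith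
  have hx0 : (R 2).alloc b 0 = 0 := by
    have := hA.sum_le
    rw [Fin.sum_univ_two] at this
    omega
  have hprice : uniformPrice (R 2) b = 0 := by
    refine le_antisymm (uniformPrice_le le_rfl fun i j h1 h2 => ?_) (uniformPrice_nonneg _ _)
    fin_cases i
    · exact (hb0 j).le
    · change (R 2).alloc b 1 < j at h1
      omega
  have hnash : IsPureNash (R 2) v b := by
    refine ⟨fun i s hs1 hsk => ?_, fun i b' _ => ?_⟩
    · fin_cases i
      · change ∑ j ∈ Icc 1 s, (b 0).marginal j ≤ (s : ℝ)
        simp [hb0]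
      · change ∑ j ∈ Icc 1 s, (b 1).marginal j ≤ if s = 0 then 0 else (k : ℝ)
        rw [if_neg (by omega), sum_congr rfl fun j hj => hb1 j ((mem_Icc.1 hj).2.trans hsk)]
        simpa using hsk
    · fin_cases i
      · change utility (R 2) v (Function.update b 0 b') 0 ≤ utility (R 2) v b 0
        have h1 : utility (R 2) v b 0 = 0 := by simp [utility, hx0, v]
        rw [h1]
        set c := Function.update b 0 b' with hc
        have hA' := (R 2).isAllocation c
        have hsum := hA'.sum_le
        rw [Fin.sum_univ_two] at hsum
        change ((R 2).alloc c 0 : ℝ) - (R 2).alloc c 0 * uniformPrice (R 2) c ≤ 0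
        rcases Nat.eq_zero_or_pos ((R 2).alloc c 0) with h0 | h0
        · simp [h0]
        -- Any unit won by bidder `0` displaces a bid of `1`, so the price is at least his value per
        -- unit.
        · have hp := marginal_le_uniformPrice (R := R 2) (b := c) (i := 1) (j := k) (by omega) le_rfl
          have hc1 : c 1 = b 1 := by simp [hc]
          rw [hc1, hb1 k le_rfl] at hp
          have := mul_le_mul_of_nonneg_left hp (Nat.cast_nonneg (α := ℝ) ((R 2).alloc c 0))
          linarith
      · change utility (R 2) v (Function.update b 1 b') 1 ≤ utility (R 2) v b 1
        refine (utility_le _ _ _ _).trans ?_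
        have h1 : utility (R 2) v b 1 = k := by
          simp [utility, hx1, hprice, v, Nat.ne_of_gt hk]
        rw [h1]
        change (if _ = 0 then 0 else (k : ℝ)) ≤ k
        split_ifs
        exacts [hkp.le, le_rfl]
  have hSW : socialWelfare (R 2) v b = k := by
    simp [socialWelfare, Fin.sum_univ_two, hx0, hx1, v, Nat.ne_of_gt hk]
  have hopt : (2 - 1 / (k : ℝ)) * k ≤ optimalWelfare k v := by
    -- One unit to the unit-demand bidder and the rest to the additive one: welfare `2 * k - 1`.
    refine le_trans (le_of_eq ?_) (sum_le_optimalWelfare hv (y := ![k - 1, 1]) ?_)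
    · simp [Fin.sum_univ_two, v, Nat.cast_sub hk]
      field_simp
      ring
    · simp [Fin.sum_univ_two]
      omega
  have hle : ENNReal.ofReal (optimalWelfare k v) / ENNReal.ofReal (socialWelfare (R 2) v b) ≤
      pureNashPoA R :=
    le_iSup_of_le 2 (le_iSup_of_le v (le_iSup_of_le hv (le_iSup_of_le b
      (le_iSup_of_le hnash le_rfl))))
  refine le_trans ?_ hle
  rw [hSW, ← ENNReal.ofReal_div_of_pos hkp]
  exact ENNReal.ofReal_le_ofReal ((le_div_iff₀ hkp).2 hopt)

end UniformPriceAuction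

theorem mainTheorem12 (k : ℕ) (hk : 1 ≤ k)
    (R : (n : ℕ) → UniformPriceAuction.AllocationRule n k) :
    (9 ≤ k → ENNReal.ofReal ((1 - 1 / Real.exp 1 + 2 / (k : ℝ))⁻¹) ≤
      UniformPriceAuction.pureNashPoA R) ∧
    UniformPriceAuction.pureNashPoA R ≤ ENNReal.ofReal 3.1462 := by
  refine ⟨fun _ => le_trans (ENNReal.ofReal_le_ofReal ?_)
    (UniformPriceAuction.ofReal_two_sub_inv_le_pureNashPoA hk R),
    (UniformPriceAuction.pureNashPoA_le_three R).trans ?_⟩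
  · have hk1 : (1 : ℝ) ≤ k := by exact_mod_cast hk
    have hz1 : 1 / (k : ℝ) ≤ 1 := (div_le_one (by linarith)).2 hk1
    have hz0 : 0 < 1 / (k : ℝ) := by positivity
    have he : 1 / Real.exp 1 ≤ 1 / 2 := by
      have := Real.add_one_le_exp (1 : ℝ)
      exact one_div_le_one_div_of_le (by norm_num) (by linarith)
    have h2 : 2 / (k : ℝ) = 2 * (1 / k) := by ring
    rw [h2]
    set z := 1 / (k : ℝ)
    -- Using `e ≥ 2`, it remains that `(2 - z) * (1 / 2 + 2 * z) = 1 + 7 / 2 * z - 2 * z ^ 2 ≥ 1`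
    -- for `0 < z ≤ 1`.
    have ha : 1 / 2 + 2 * z ≤ 1 - 1 / Real.exp 1 + 2 * z := by linarith
    rw [inv_le_iff_one_le_mul₀ (by linarith)]
    refine le_trans ?_ (mul_le_mul_of_nonneg_left ha (by linarith))
    nlinarith
  · rw [← ENNReal.ofReal_ofNat 3]
    exact ENNReal.ofReal_le_ofReal (by norm_num)
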